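/- Let $L_2$ be the space of square-integrable complex functions on the unit circle $\mathbb T$ (functions being identified when they agree almost everywhere), and let $H_2\subset L_2$ be the Hardy space of functions whose negative Fourier coefficients vanish. An inner function is a $\varphi\in H_2$ with $|\varphi|=1$ almost everywhere on $\mathbb T$, and $\mathcal J=\{\varphi/\psi : \varphi,\psi \text{ inner}\}$. Functions $g^{(1)},\dots,g^{(n)}\in H_2$ are called backward deterministic if $$\overline{\sum_{j=1}^n \overline{\operatorname{span}}\{z^{-k}g^{(j)} : k\ge 0\}}=L_2 ,$$ the closures being taken in $L_2$. Let $n\ge 1$ and let $g^{(1)},\dots,g^{(n)}\in H_2$ all be non-zero. Then $g^{(1)},\dots,g^{(n)}$ are backward deterministic if and only if $$\frac{g^{(1)}}{\overline{g^{(1)}}}\,\frac{\overline{g^{(j)}}}{g^{(j)}}\notin\mathcal J\quad\text{for some } j\in\{2,\dots,n\}.$$ -/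

import Mathlib

open MeasureTheory
open scoped ComplexConjugate ENNReal

noncomputable section

namespace HardyCircle

instance factTwoPiPos : Fact (0 < 2 * Real.pi) := ⟨Real.two_pi_pos⟩

/-- The unit circle, parametrized by the angle `θ ∈ ℝ / 2πℤ`; the coordinate `z = e^{iθ}` is
`fourier 1`, and `z ^ m` is `fourier m`. -/
abbrev 𝕋 : Type := AddCircle (2 * Real.pi)

/-- Normalized Lebesgue measure `dθ / 2π` on the unit circle. -/
abbrev circleMeasure : Measure 𝕋 := AddCircle.haarAddCircle

/-- The complex Hilbert space `L₂` of square-integrable functions on the unit circle. -/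
abbrev L2 : Type := Lp ℂ 2 circleMeasure

/-- The Hardy space `H₂`: functions in `L₂` whose negative Fourier coefficients vanish. -/
def H2 : Submodule ℂ L2 where
  carrier := {f | ∀ m : ℤ, m < 0 → fourierCoeff (f : 𝕋 → ℂ) m = 0}
  zero_mem' := by
    intro m _
    rw [← fourierBasis_repr]
    simp
  add_mem' := by
    intro f g hf hg m hm
    have h1 := hf m hm
    have h2 := hg m hm
    rw [← fourierBasis_repr] at h1 h2 ⊢
    simp [h1, h2]
  smul_mem' := by
    intro c f hf m hm
    have h1 := hf m hm
    rw [← fourierBasis_repr] at h1 ⊢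
    simp [h1]

/-- `f ∈ L₂` implies `z ^ m f ∈ L₂`. -/
theorem memLp_fourier_mul (m : ℤ) (f : L2) :
    MemLp (fun t : 𝕋 => fourier m t * f t) 2 circleMeasure := by
  refine (Lp.memLp f).of_le ?_ ?_
  · exact (fourier m).continuous.aestronglyMeasurable.mul (Lp.aestronglyMeasurable f)
  · exact Filter.Eventually.of_forall fun t => by
      rw [norm_mul, fourier_apply, Circle.norm_coe, one_mul]

/-- Multiplication by `z ^ m` on `L₂`, for an integer `m`. -/
def zpowMul (m : ℤ) (f : L2) : L2 := (memLp_fourier_mul m f).toLp _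

/-- The closed linear span of `{z ^ (-k) g : k ≥ 0}` in `L₂`. -/
def backwardSpan (g : L2) : Submodule ℂ L2 :=
  (Submodule.span ℂ (Set.range fun k : ℕ => zpowMul (-(k : ℤ)) g)).topologicalClosure

/-- The functions `g j` are backward deterministic: the sum of the subspaces `backwardSpan (g j)`,
as a sum of closed subspaces (the closure of the algebraic sum), is all of `L₂`. -/
def IsBackwardDeterministic {ι : Type*} (g : ι → L2) : Prop :=
  (⨆ j, backwardSpan (g j)).topologicalClosure = ⊤

/-- Inner functions, through their boundary values: functions in `H₂` that are unimodular almost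
everywhere on the circle. -/
def IsInner (φ : L2) : Prop :=
  φ ∈ H2 ∧ ∀ᵐ t ∂circleMeasure, ‖φ t‖ = 1

/-- The set `𝒥` of quotients of inner functions. Functions on the circle are considered up to
almost everywhere equality. -/
def innerQuotients : Set (𝕋 → ℂ) :=
  {u | ∃ φ ψ : L2, IsInner φ ∧ IsInner ψ ∧ u =ᵐ[circleMeasure] fun t => φ t / ψ t}

end HardyCircle

end

/-!
Let `M` be the closed sum of the backward spans. The proof looks at its orthogonal complement, which
is a closed subspace invariant under multiplication by `z`.

The engine is the Helson–Lowdenslager argument (`exists_unimodular_mem`): a closed subspace `K` with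
`z K ⊆ K` but not `z⁻¹ K ⊆ K` contains a unimodular function, because a unit vector `e` of `K ⊖ z K`
is orthogonal to all `z ^ k e`, `k ≥ 1`, so that `|e|²` has the Fourier coefficients of `1`. Applied
to the cyclic subspace of a nonzero `g ∈ H₂`, it gives an inner function `e` there. Two consequences
replace the inner-outer factorization:

* `g ≠ 0` almost everywhere (`ae_ne_zero_of_mem_H2`), as `e` vanishes wherever `g` does;
* if `w` is unimodular and `w g ∈ H₂`, then `w e ∈ H₂` is inner, so `w = (w e) / e ∈ 𝒥`
  (`mem_innerQuotients_of_mul_mem_H2`).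

If `M ≠ L₂`, the engine applied to `Mᗮ` gives a unimodular `v ⟂ M`. Orthogonality to `z ^ (-k) g j`
says that `v * conj (g j) ∈ H₂`, so `w j = v * conj (g j) / g j ∈ 𝒥` by the second consequence, and
the ratios in the theorem are the quotients `w j / w 0`.

Conversely, if all ratios are quotients of inner functions, let `p` be a common inner multiple of
the denominators. Then `z p g 0 / conj (g 0)` is unimodular and orthogonal to `M`
(`not_isBackwardDeterministic`).
-/

noncomputable section

namespace HardyCircle

open Filter Topology InnerProductSpace

/-! ### Fourier coefficients of integrable functions -/

theorem conj_fourier (m : ℤ) (t : 𝕋) : conj (fourier m t : ℂ) = fourier (-m) t :=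
  fourier_neg.symm

theorem norm_fourier_apply (m : ℤ) (t : 𝕋) : ‖(fourier m t : ℂ)‖ = 1 := by
  rw [fourier_apply, Circle.norm_coe]

/-- Trigonometric polynomials are dense in the continuous functions, so vanishing Fourier
coefficients force the integral against every continuous function to vanish. -/
theorem integral_continuous_mul_eq_zero {f : 𝕋 → ℂ} (hf : Integrable f circleMeasure)
    (h : ∀ m : ℤ, fourierCoeff f m = 0) (φ : C(𝕋, ℂ)) :
    ∫ t, φ t * f t ∂circleMeasure = 0 := by
  have hint : ∀ φ : C(𝕋, ℂ), Integrable (fun t => φ t * f t) circleMeasure := fun φ =>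
    hf.bdd_mul φ.continuous.aestronglyMeasurable (c := ‖φ‖)
      (Eventually.of_forall fun t => φ.norm_coe_le_norm t)
  let I : C(𝕋, ℂ) →ₗ[ℂ] ℂ :=
    { toFun := fun φ => ∫ t, φ t * f t ∂circleMeasure
      map_add' := fun φ ψ => by
        rw [← integral_add (hint φ) (hint ψ)]
        simp [add_mul]
      map_smul' := fun c φ => by
        simp [mul_assoc, integral_const_mul] }
  let J : C(𝕋, ℂ) →L[ℂ] ℂ := I.mkContinuous (∫ t, ‖f t‖ ∂circleMeasure) fun φ => by
    rw [mul_comm (∫ t, ‖f t‖ ∂circleMeasure) ‖φ‖, ← integral_const_mul]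
    refine norm_integral_le_of_norm_le (hf.norm.const_mul _) (Eventually.of_forall fun t => ?_)
    rw [norm_mul]
    exact mul_le_mul_of_nonneg_right (φ.norm_coe_le_norm t) (norm_nonneg _)
  have hle : (Submodule.span ℂ (Set.range (@fourier (2 * Real.pi)))).topologicalClosure ≤
      LinearMap.ker J.toLinearMap := by
    refine Submodule.topologicalClosure_minimal _ ?_ J.isClosed_ker
    rw [Submodule.span_le]
    rintro _ ⟨m, rfl⟩
    have := h (-m)
    rw [fourierCoeff, neg_neg] at this
    exact this
  rw [span_fourier_closure_eq_top] at hle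
  exact hle (Submodule.mem_top : φ ∈ _)

/-- Uniqueness of Fourier coefficients in `L₁`. -/
theorem ae_eq_zero_of_fourierCoeff_eq_zero {f : 𝕋 → ℂ} (hf : Integrable f circleMeasure)
    (h : ∀ m : ℤ, fourierCoeff f m = 0) : f =ᵐ[circleMeasure] 0 := by
  refine ae_eq_zero_of_forall_setIntegral_isClosed_eq_zero hf fun s hs => ?_
  let F : ℕ → 𝕋 → ℂ := fun n t => (((hs.apprSeq n t : NNReal) : ℝ) : ℂ) * f t
  have hzero : ∀ n, ∫ t, F n t ∂circleMeasure = 0 := fun n =>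
    integral_continuous_mul_eq_zero hf h
      ⟨fun t => (((hs.apprSeq n t : NNReal) : ℝ) : ℂ), by fun_prop⟩
  have hlim : Tendsto (fun n => ∫ t, F n t ∂circleMeasure) atTop
      (𝓝 (∫ t, s.indicator f t ∂circleMeasure)) := by
    refine tendsto_integral_of_dominated_convergence (fun t => ‖f t‖) (fun n => ?_) hf.norm
      (fun n => Eventually.of_forall fun t => ?_) (Eventually.of_forall fun t => ?_)
    · exact (Continuous.aestronglyMeasurable (by fun_prop)).mul hf.aestronglyMeasurable
    · have h1 : ((hs.apprSeq n t : NNReal) : ℝ) ≤ 1 := by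
        exact_mod_cast HasOuterApproxClosed.apprSeq_apply_le_one hs n t
      simp only [F, norm_mul, Complex.norm_real, Real.norm_eq_abs, NNReal.abs_eq]
      exact mul_le_of_le_one_left (norm_nonneg _) h1
    · have h1 := tendsto_pi_nhds.1 (HasOuterApproxClosed.tendsto_apprSeq hs) t
      have h2 : Tendsto (fun n => F n t) atTop
          (𝓝 ((((s.indicator (fun _ => (1 : NNReal)) t : NNReal) : ℝ) : ℂ) * f t)) :=
        (((Complex.continuous_ofReal.comp NNReal.continuous_coe).tendsto _).comp h1).mul_const _
      by_cases ht : t ∈ s <;> simpa [ht] using h2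
  simp_rw [hzero] at hlim
  rw [← integral_indicator hs.measurableSet]
  exact tendsto_nhds_unique hlim tendsto_const_nhds

/-! ### Multiplication by unimodular functions and by powers of `z` -/

theorem memLp_mul_of_unimodular {w : 𝕋 → ℂ} (hw : AEStronglyMeasurable w circleMeasure)
    (h1 : ∀ᵐ t ∂circleMeasure, ‖w t‖ = 1) (f : L2) :
    MemLp (fun t => w t * f t) 2 circleMeasure :=
  (Lp.memLp f).of_le (hw.mul (Lp.aestronglyMeasurable f)) <| by
    filter_upwards [h1] with t ht
    rw [norm_mul, ht, one_mul]

/-- Multiplication by a unimodular measurable function, as an isometry of `L₂`. -/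
def mulUnimodular (w : 𝕋 → ℂ) (hw : AEStronglyMeasurable w circleMeasure)
    (h1 : ∀ᵐ t ∂circleMeasure, ‖w t‖ = 1) : L2 →ₗᵢ[ℂ] L2 :=
  have hmem := memLp_mul_of_unimodular hw h1
  { toFun := fun f => (hmem f).toLp _
    map_add' := fun f g => by
      rw [← MemLp.toLp_add]
      refine MemLp.toLp_congr _ _ ?_
      filter_upwards [Lp.coeFn_add f g] with t ht
      rw [ht, Pi.add_apply, Pi.add_apply, mul_add]
    map_smul' := fun c f => by
      rw [RingHom.id_apply, ← MemLp.toLp_const_smul]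
      refine MemLp.toLp_congr _ _ ?_
      filter_upwards [Lp.coeFn_smul c f] with t ht
      rw [ht, Pi.smul_apply, Pi.smul_apply, smul_eq_mul, smul_eq_mul, mul_left_comm]
    norm_map' := fun f => by
      change ‖(hmem f).toLp _‖ = ‖f‖
      rw [Lp.norm_toLp, Lp.norm_def]
      congr 1
      refine eLpNorm_congr_norm_ae ?_
      filter_upwards [h1] with t ht
      rw [norm_mul, ht, one_mul] }

theorem coeFn_mulUnimodular (w : 𝕋 → ℂ) (hw : AEStronglyMeasurable w circleMeasure)
    (h1 : ∀ᵐ t ∂circleMeasure, ‖w t‖ = 1) (f : L2) :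
    mulUnimodular w hw h1 f =ᵐ[circleMeasure] fun t => w t * f t :=
  MemLp.coeFn_toLp (memLp_mul_of_unimodular hw h1 f)

theorem coeFn_zpowMul (m : ℤ) (f : L2) :
    zpowMul m f =ᵐ[circleMeasure] fun t => fourier m t * f t :=
  MemLp.coeFn_toLp _

/-- Multiplication by `z ^ m` as a linear isometry of `L₂`. -/
def shift (m : ℤ) : L2 →ₗᵢ[ℂ] L2 :=
  mulUnimodular (fourier m) (fourier m).continuous.aestronglyMeasurable
    (Eventually.of_forall (norm_fourier_apply m))

theorem shift_apply (m : ℤ) (f : L2) : shift m f = zpowMul m f := rfl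

theorem zpowMul_zpowMul (m k : ℤ) (f : L2) : zpowMul m (zpowMul k f) = zpowMul (m + k) f := by
  refine Lp.ext ?_
  filter_upwards [coeFn_zpowMul m (zpowMul k f), coeFn_zpowMul k f, coeFn_zpowMul (m + k) f]
    with t h1 h2 h3
  rw [h1, h2, h3, fourier_add, mul_assoc]

theorem zpowMul_zero (f : L2) : zpowMul 0 f = f := by
  refine Lp.ext ?_
  filter_upwards [coeFn_zpowMul 0 f] with t h1
  rw [h1, fourier_zero, one_mul]

/-! ### Inner products as Fourier coefficients, and the Hardy space -/

theorem inner_eq_integral (f g : L2) :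
    ⟪f, g⟫_ℂ = ∫ t, conj (f t) * g t ∂circleMeasure := by
  rw [L2.inner_def]
  refine integral_congr_ae (Eventually.of_forall fun t => ?_)
  simp [mul_comm]

theorem integrable_conj_mul (f g : L2) :
    Integrable (fun t => conj (f t) * g t) circleMeasure := by
  refine (L2.integrable_inner (𝕜 := ℂ) f g).congr (Eventually.of_forall fun t => ?_)
  simp [mul_comm]

/-- The inner products `⟪z ^ m f, g⟫` are the Fourier coefficients of `conj f * g`. -/
theorem inner_zpowMul_left (m : ℤ) (f g : L2) :
    ⟪zpowMul m f, g⟫_ℂ = fourierCoeff (fun t => conj (f t) * g t) m := by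
  rw [inner_eq_integral, fourierCoeff]
  refine integral_congr_ae ?_
  filter_upwards [coeFn_zpowMul m f] with t ht
  simp only [ht, map_mul, conj_fourier, smul_eq_mul, mul_assoc]

theorem inner_zpowMul_zpowMul (m k : ℤ) (f g : L2) :
    ⟪zpowMul m f, zpowMul k g⟫_ℂ = ⟪zpowMul (m - k) f, g⟫_ℂ := by
  have h := (shift k).inner_map_map (zpowMul (m - k) f) g
  rw [shift_apply, shift_apply, zpowMul_zpowMul] at h
  rw [← h]
  congr 2
  ring

theorem fourierCoeff_zpowMul (m k : ℤ) (f : L2) :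
    fourierCoeff (zpowMul m f : 𝕋 → ℂ) k = fourierCoeff (f : 𝕋 → ℂ) (k - m) := by
  rw [fourierCoeff, fourierCoeff]
  refine integral_congr_ae ?_
  filter_upwards [coeFn_zpowMul m f] with t ht
  rw [ht, smul_eq_mul, smul_eq_mul, ← mul_assoc, ← fourier_add]
  congr 3
  ring

theorem fourierCoeff_eq_inner (f : L2) (m : ℤ) :
    fourierCoeff (f : 𝕋 → ℂ) m = ⟪(fourierLp 2 m : L2), f⟫_ℂ := by
  rw [← fourierBasis_repr, HilbertBasis.repr_apply_apply, coe_fourierBasis]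

theorem eq_zero_of_fourierCoeff_eq_zero {f : L2}
    (h : ∀ m : ℤ, fourierCoeff (f : 𝕋 → ℂ) m = 0) : f = 0 := by
  have : fourierBasis.repr f = 0 := by
    ext m
    rw [fourierBasis_repr, h m]
    rfl
  simpa using this

theorem isClosed_H2 : IsClosed (H2 : Set L2) := by
  have : (H2 : Set L2) = ⋂ m : ℤ, ⋂ _ : m < 0, {f : L2 | ⟪(fourierLp 2 m : L2), f⟫_ℂ = 0} := by
    ext f
    simp only [Set.mem_iInter, Set.mem_ofPred_eq, ← fourierCoeff_eq_inner]
    rfl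
  rw [this]
  exact isClosed_iInter fun m => isClosed_iInter fun _ =>
    isClosed_eq (by fun_prop) continuous_const

theorem zpowMul_mem_H2 {f : L2} (hf : f ∈ H2) {k : ℤ} (hk : 0 ≤ k) : zpowMul k f ∈ H2 := by
  intro m hm
  rw [fourierCoeff_zpowMul]
  exact hf _ (by omega)

theorem zpowMul_iterate_mem {K : Submodule ℂ L2} {a : ℤ} (hK : ∀ f ∈ K, zpowMul a f ∈ K)
    {f : L2} (hf : f ∈ K) (n : ℕ) : zpowMul (n * a) f ∈ K := by
  induction n with
  | zero => simpa [zpowMul_zero] using hf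
  | succ n ih =>
    have := hK _ ih
    rw [zpowMul_zpowMul] at this
    convert this using 2
    push_cast
    ring

/-! ### Unimodular functions in invariant subspaces -/

/-- The invariant subspace argument of Helson and Lowdenslager: a unit vector of `K ⊖ zK` has
`|e|²` with the Fourier coefficients of the constant `1`. -/
theorem exists_unimodular_mem {K : Submodule ℂ L2} (hc : IsClosed (K : Set L2))
    (hK : ∀ f ∈ K, zpowMul 1 f ∈ K) (hne : ∃ f ∈ K, zpowMul (-1) f ∉ K) :
    ∃ e ∈ K, ∀ᵐ t ∂circleMeasure, ‖e t‖ = 1 := by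
  let Z : Submodule ℂ L2 := K.map (shift 1).toLinearMap
  have hZK : Z ≤ K := by
    rintro _ ⟨f, hf, rfl⟩
    exact hK f hf
  have hZc : IsClosed (Z : Set L2) := by
    have := (shift 1).isometry.isClosedEmbedding.isClosedMap _ hc
    simpa [Z] using this
  have : CompleteSpace Z := hZc.completeSpace_coe
  have hbot : Zᗮ ⊓ K ≠ ⊥ := by
    intro hb
    have hs := Submodule.sup_orthogonal_inf_of_hasOrthogonalProjection hZK
    rw [hb, sup_bot_eq] at hs
    obtain ⟨f, hf, hf'⟩ := hne
    rw [← hs] at hf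
    obtain ⟨f₁, hf₁, rfl⟩ := hf
    refine hf' ?_
    change zpowMul (-1) (zpowMul 1 f₁) ∈ K
    rw [zpowMul_zpowMul, neg_add_cancel, zpowMul_zero]
    exact hf₁
  obtain ⟨e₀, he₀, hne₀⟩ := Submodule.exists_mem_ne_zero_of_ne_bot hbot
  let e : L2 := ((‖e₀‖ : ℂ)⁻¹) • e₀
  have heZ : e ∈ Zᗮ ⊓ K := Submodule.smul_mem _ _ he₀
  have hnorm : ‖e‖ = 1 := norm_smul_inv_norm hne₀
  have hpos : ∀ k : ℕ, fourierCoeff (fun t => conj (e t) * e t) ((k : ℤ) + 1) = 0 := by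
    intro k
    rw [← inner_zpowMul_left]
    have h1 := zpowMul_iterate_mem hK heZ.2 k
    have h2 := (Submodule.mem_orthogonal _ _).1 heZ.1 _ (Submodule.mem_map_of_mem h1)
    change ⟪zpowMul 1 (zpowMul _ e), e⟫_ℂ = 0 at h2
    rwa [zpowMul_zpowMul, mul_one, add_comm] at h2
  have hneg : ∀ k : ℕ, fourierCoeff (fun t => conj (e t) * e t) (-((k : ℤ) + 1)) = 0 := by
    intro k
    have h := hpos k
    rw [← inner_zpowMul_left] at h ⊢
    rw [inner_eq_zero_symm]
    have h3 := inner_zpowMul_zpowMul 0 (-((k : ℤ) + 1)) e e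
    rw [zpowMul_zero, zero_sub, neg_neg] at h3
    rw [h3, h]
  have hone : fourierCoeff (fun t => conj (e t) * e t) 0 = 1 := by
    rw [← inner_zpowMul_left, zpowMul_zero, inner_self_eq_norm_sq_to_K, hnorm]
    simp
  have hint := integrable_conj_mul e e
  have hcoe1 : ∀ m : ℤ, fourierCoeff (fun _ : 𝕋 => (-1 : ℂ)) m = if m = 0 then -1 else 0 := by
    intro m
    have h1 := fourierCoeff.const_mul (T := 2 * Real.pi) (fourier 0) (-1) m
    simp only [fourier_zero, mul_one] at h1
    rw [h1]
    have h2 := congrFun (fourierCoeff_fourier (T := 2 * Real.pi) 0) m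
    rw [h2, Pi.single_apply]
    split_ifs <;> simp
  have hz : (fun t => conj (e t) * e t) + (fun _ => (-1 : ℂ)) =ᵐ[circleMeasure] 0 := by
    refine ae_eq_zero_of_fourierCoeff_eq_zero (hint.add (integrable_const _)) fun m => ?_
    rw [fourierCoeff.add hint (integrable_const _), Pi.add_apply, hcoe1]
    rcases lt_trichotomy m 0 with hm | rfl | hm
    · obtain ⟨k, rfl⟩ : ∃ k : ℕ, m = -((k : ℤ) + 1) := ⟨(-m - 1).toNat, by omega⟩
      rw [hneg, if_neg hm.ne, add_zero]
    · rw [hone, if_pos rfl]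
      norm_num
    · obtain ⟨k, rfl⟩ : ∃ k : ℕ, m = (k : ℤ) + 1 := ⟨(m - 1).toNat, by omega⟩
      rw [hpos, if_neg hm.ne', add_zero]
  refine ⟨e, heZ.2, ?_⟩
  filter_upwards [hz] with t ht
  have h1 : conj (e t) * e t = 1 := by
    have : conj (e t) * e t + -1 = 0 := ht
    linear_combination this
  rw [Complex.conj_mul'] at h1
  have h2 : ‖e t‖ ^ 2 = 1 := by exact_mod_cast h1
  nlinarith [norm_nonneg (e t)]


/-! ### Cyclic subspaces of the shift -/

/-- The cyclic subspace of the shift generated by `g`: the closed linear span of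
`{z ^ k g : k ≥ 0}` in `L₂`. -/
def forwardSpan (g : L2) : Submodule ℂ L2 :=
  (Submodule.span ℂ (Set.range fun k : ℕ => zpowMul (k : ℤ) g)).topologicalClosure

theorem forwardSpan_le {g : L2} {K : Submodule ℂ L2} (hc : IsClosed (K : Set L2))
    (h : ∀ k : ℕ, zpowMul (k : ℤ) g ∈ K) : forwardSpan g ≤ K := by
  refine Submodule.topologicalClosure_minimal _ ?_ hc
  rw [Submodule.span_le]
  rintro _ ⟨k, rfl⟩
  exact h k

theorem zpowMul_mem_forwardSpan (g : L2) (k : ℕ) : zpowMul (k : ℤ) g ∈ forwardSpan g :=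
  Submodule.le_topologicalClosure _ (Submodule.subset_span ⟨k, rfl⟩)

theorem zpowMul_one_mem_forwardSpan {g f : L2} (hf : f ∈ forwardSpan g) :
    zpowMul 1 f ∈ forwardSpan g := by
  have hle : forwardSpan g ≤ (forwardSpan g).comap (shift 1).toLinearMap := by
    refine forwardSpan_le ?_ fun k => ?_
    · exact (Submodule.isClosed_topologicalClosure _).preimage (shift 1).continuous
    · rw [Submodule.mem_comap, LinearIsometry.coe_toLinearMap, shift_apply, zpowMul_zpowMul,
        add_comm, ← Nat.cast_succ]
      exact zpowMul_mem_forwardSpan g (k + 1)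
  have h := hle hf
  rwa [Submodule.mem_comap, LinearIsometry.coe_toLinearMap, shift_apply] at h

/-- Every nonzero `g ∈ H₂` has an inner function in its cyclic subspace. The subspace is not
invariant under `z⁻¹`, for no nonzero function stays in `H₂` under all negative powers of `z`. -/
theorem exists_isInner_mem_forwardSpan {g : L2} (hg : g ∈ H2) (hg0 : g ≠ 0) :
    ∃ e ∈ forwardSpan g, IsInner e := by
  have hH : forwardSpan g ≤ H2 :=
    forwardSpan_le isClosed_H2 fun k => zpowMul_mem_H2 hg (Int.natCast_nonneg k)
  have hne : ∃ f ∈ forwardSpan g, zpowMul (-1) f ∉ forwardSpan g := by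
    by_contra! hcon
    refine hg0 (eq_zero_of_fourierCoeff_eq_zero fun m => ?_)
    have hmem : g ∈ forwardSpan g := by
      simpa [zpowMul_zero] using zpowMul_mem_forwardSpan g 0
    have h1 := hH (zpowMul_iterate_mem hcon hmem (m.toNat + 1)) (m - (m.toNat + 1)) (by omega)
    rw [fourierCoeff_zpowMul] at h1
    convert h1 using 2
    push_cast
    ring
  obtain ⟨e, he, he1⟩ := exists_unimodular_mem (Submodule.isClosed_topologicalClosure _)
    (fun f hf => zpowMul_one_mem_forwardSpan hf) hne
  exact ⟨e, he, hH he, he1⟩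

/-- The theorem of F. and M. Riesz for `H₂`: the inner function in the cyclic subspace of `g`
vanishes wherever `g` does, but it is unimodular. -/
theorem ae_ne_zero_of_mem_H2 {g : L2} (hg : g ∈ H2) (hg0 : g ≠ 0) :
    ∀ᵐ t ∂circleMeasure, g t ≠ 0 := by
  obtain ⟨e, he, -, he1⟩ := exists_isInner_mem_forwardSpan hg hg0
  have hE : MeasurableSet {t : 𝕋 | g t = 0} :=
    (Lp.stronglyMeasurable g).measurable (measurableSet_singleton 0)
  -- `p` is the part of `e` on the zero set of `g`; it is orthogonal to all `z ^ k g`.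
  have hp : MemLp ({t : 𝕋 | g t = 0}.indicator e) 2 circleMeasure := (Lp.memLp e).indicator hE
  let p : L2 := hp.toLp _
  have hpc : p =ᵐ[circleMeasure] {t : 𝕋 | g t = 0}.indicator e := hp.coeFn_toLp
  have hperp : forwardSpan g ≤ (ℂ ∙ p)ᗮ := by
    refine forwardSpan_le (Submodule.isClosed_orthogonal _) fun k => ?_
    rw [Submodule.mem_orthogonal_singleton_iff_inner_left, inner_eq_integral]
    refine integral_eq_zero_of_ae ?_
    filter_upwards [hpc, coeFn_zpowMul k g] with t h1 h2
    rw [h1, h2]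
    by_cases ht : g t = 0 <;> simp [ht]
  have h0 : p = 0 := by
    rw [← inner_self_eq_zero (𝕜 := ℂ)]
    have h1 := Submodule.mem_orthogonal_singleton_iff_inner_left.1 (hperp he)
    rw [inner_eq_integral] at h1 ⊢
    rw [← h1]
    refine integral_congr_ae ?_
    filter_upwards [hpc] with t h2
    rw [h2]
    by_cases ht : g t = 0 <;> simp [ht]
  rw [h0] at hpc
  filter_upwards [hpc, Lp.coeFn_zero ℂ 2 circleMeasure, he1] with t h1 h2 h3 ht
  rw [h2, Set.indicator_of_mem (by exact ht)] at h1
  rw [← h1] at h3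
  simp at h3

theorem zpowMul_mulUnimodular (w : 𝕋 → ℂ) (hw : AEStronglyMeasurable w circleMeasure)
    (h1 : ∀ᵐ t ∂circleMeasure, ‖w t‖ = 1) (k : ℤ) (g : L2) :
    zpowMul k (mulUnimodular w hw h1 g) = mulUnimodular w hw h1 (zpowMul k g) := by
  refine Lp.ext ?_
  filter_upwards [coeFn_zpowMul k (mulUnimodular w hw h1 g), coeFn_zpowMul k g,
    coeFn_mulUnimodular w hw h1 g, coeFn_mulUnimodular w hw h1 (zpowMul k g)] with t a b c d
  rw [a, d, b, c, mul_left_comm]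

/-- If `w` is unimodular and `g`, `w g` are both in `H₂`, then `w` is a quotient of inner
functions: multiplication by `w` carries an inner function `e` of the cyclic subspace of `g` into
the cyclic subspace of `w g`, so `w = (w e) / e`. -/
theorem mem_innerQuotients_of_mul_mem_H2 {g : L2} (hg : g ∈ H2) (hg0 : g ≠ 0) {w : 𝕋 → ℂ}
    (hw : AEStronglyMeasurable w circleMeasure) (h1 : ∀ᵐ t ∂circleMeasure, ‖w t‖ = 1)
    (hwg : mulUnimodular w hw h1 g ∈ H2) : w ∈ innerQuotients := by
  obtain ⟨e, he, hin⟩ := exists_isInner_mem_forwardSpan hg hg0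
  have hle : forwardSpan g ≤ H2.comap (mulUnimodular w hw h1).toLinearMap := by
    refine forwardSpan_le (isClosed_H2.preimage (mulUnimodular w hw h1).continuous) fun k => ?_
    rw [Submodule.mem_comap, LinearIsometry.coe_toLinearMap, ← zpowMul_mulUnimodular]
    exact zpowMul_mem_H2 hwg (Int.natCast_nonneg k)
  have hmem := hle he
  rw [Submodule.mem_comap, LinearIsometry.coe_toLinearMap] at hmem
  have hwe := coeFn_mulUnimodular w hw h1 e
  refine ⟨mulUnimodular w hw h1 e, e, ⟨hmem, ?_⟩, hin, ?_⟩
  · filter_upwards [hwe, h1, hin.2] with t a b c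
    rw [a, norm_mul, b, c, one_mul]
  · filter_upwards [hwe, hin.2] with t a c
    have : e t ≠ 0 := norm_ne_zero_iff.1 (by rw [c]; exact one_ne_zero)
    rw [a, mul_div_cancel_right₀ _ this]

/-! ### Arithmetic of inner functions -/

/-- `H₂` is closed under multiplication by inner functions. -/
theorem IsInner.mul_mem_H2 {φ f p : L2} (hφ : IsInner φ) (hf : f ∈ H2)
    (hp : p =ᵐ[circleMeasure] fun t => φ t * f t) : p ∈ H2 := by
  intro m hm
  -- Parseval for `conj φ * z ^ m` and `f`: each term has a vanishing factor.
  let q : L2 := mulUnimodular (fun t => conj (φ t))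
    (Complex.continuous_conj.comp_aestronglyMeasurable (Lp.aestronglyMeasurable φ))
    (by simpa using hφ.2) (fourierLp 2 m)
  have hq : q =ᵐ[circleMeasure] fun t => conj (φ t) * (fourierLp 2 m : L2) t :=
    coeFn_mulUnimodular _ _ _ _
  have h1 : fourierCoeff (p : 𝕋 → ℂ) m = ⟪q, f⟫_ℂ := by
    rw [fourierCoeff_eq_inner, inner_eq_integral, inner_eq_integral]
    refine integral_congr_ae ?_
    filter_upwards [hp, hq] with t a b
    rw [a, b, map_mul, Complex.conj_conj]
    ring
  rw [h1, ← fourierBasis.tsum_inner_mul_inner q f]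
  refine (tsum_congr fun n => ?_).trans tsum_zero
  rw [coe_fourierBasis, ← fourierCoeff_eq_inner]
  rcases lt_or_ge n 0 with hn | hn
  · rw [hf n hn, mul_zero]
  · have h2 : ⟪q, (fourierLp 2 n : L2)⟫_ℂ = fourierCoeff (φ : 𝕋 → ℂ) (m - n) := by
      rw [inner_eq_integral, fourierCoeff]
      refine integral_congr_ae ?_
      filter_upwards [hq, coeFn_fourierLp (T := 2 * Real.pi) 2 m,
        coeFn_fourierLp (T := 2 * Real.pi) 2 n] with t a b c
      rw [a, b, c, map_mul, Complex.conj_conj, conj_fourier, smul_eq_mul, neg_sub, sub_eq_add_neg,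
        fourier_add]
      ring
    rw [h2, hφ.1 _ (by omega), zero_mul]

theorem IsInner.exists_mul {φ ψ : L2} (hφ : IsInner φ) (hψ : IsInner ψ) :
    ∃ p : L2, IsInner p ∧ p =ᵐ[circleMeasure] fun t => φ t * ψ t := by
  have hp := coeFn_mulUnimodular φ (Lp.aestronglyMeasurable φ) hφ.2 ψ
  refine ⟨_, ⟨hφ.mul_mem_H2 hψ.1 hp, ?_⟩, hp⟩
  filter_upwards [hp, hφ.2, hψ.2] with t a b c
  rw [a, norm_mul, b, c, one_mul]

/-- The coordinate function `z ^ k`, `k ≥ 0`, is inner. -/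
theorem isInner_fourierLp {k : ℤ} (hk : 0 ≤ k) : IsInner (fourierLp 2 k : L2) := by
  refine ⟨fun m hm => ?_, ?_⟩
  · rw [fourierCoeff_eq_inner, orthonormal_iff_ite.1 orthonormal_fourier m k,
      if_neg (by omega)]
  · filter_upwards [coeFn_fourierLp (T := 2 * Real.pi) 2 k] with t ht
    rw [ht, norm_fourier_apply]

theorem div_mem_innerQuotients {u w : 𝕋 → ℂ} (hu : u ∈ innerQuotients)
    (hw : w ∈ innerQuotients) : (fun t => u t / w t) ∈ innerQuotients := by
  obtain ⟨φ, ψ, hφ, hψ, h⟩ := hu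
  obtain ⟨φ', ψ', hφ', hψ', h'⟩ := hw
  obtain ⟨p, hp, hpc⟩ := hφ.exists_mul hψ'
  obtain ⟨q, hq, hqc⟩ := hψ.exists_mul hφ'
  refine ⟨p, q, hp, hq, ?_⟩
  filter_upwards [h, h', hpc, hqc] with t a b c d
  rw [a, b, c, d, div_div_div_eq]

/-- A finite family of inner functions has a common inner multiple. -/
theorem exists_isInner_common_multiple {ι : Type*} (s : Finset ι) (ψ : ι → L2)
    (hψ : ∀ j ∈ s, IsInner (ψ j)) :
    ∃ p : L2, IsInner p ∧ ∀ j ∈ s, ∃ q : L2, IsInner q ∧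
      p =ᵐ[circleMeasure] fun t => q t * ψ j t := by
  classical
  induction s using Finset.induction_on with
  | empty => exact ⟨_, isInner_fourierLp le_rfl, by simp⟩
  | insert i s hi ih =>
    obtain ⟨p, hp, hpq⟩ := ih fun j hj => hψ j (Finset.mem_insert_of_mem hj)
    have hψi := hψ i (Finset.mem_insert_self i s)
    obtain ⟨p', hp', hpc'⟩ := hp.exists_mul hψi
    refine ⟨p', hp', fun j hj => ?_⟩
    rcases Finset.mem_insert.1 hj with rfl | hj
    · exact ⟨p, hp, hpc'⟩
    · obtain ⟨q, hq, hqc⟩ := hpq j hj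
      obtain ⟨q', hq', hqc'⟩ := hq.exists_mul hψi
      refine ⟨q', hq', ?_⟩
      filter_upwards [hpc', hqc, hqc'] with t a b c
      rw [a, b, c]
      ring

/-! ### The orthogonal complement of the backward spans -/

theorem mem_orthogonal_iSup_backwardSpan {ι : Type*} (g : ι → L2) (v : L2) :
    v ∈ (⨆ j, backwardSpan (g j))ᗮ ↔
      ∀ j, ∀ k : ℕ, ⟪zpowMul (-(k : ℤ)) (g j), v⟫_ℂ = 0 := by
  rw [← Submodule.iInf_orthogonal, Submodule.mem_iInf]
  refine forall_congr' fun j => ?_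
  rw [backwardSpan, Submodule.orthogonal_closure, Submodule.mem_orthogonal]
  refine ⟨fun h k => h _ (Submodule.subset_span ⟨k, rfl⟩), fun h u hu => ?_⟩
  have hle : Submodule.span ℂ (Set.range fun k : ℕ => zpowMul (-(k : ℤ)) (g j)) ≤ (ℂ ∙ v)ᗮ := by
    rw [Submodule.span_le]
    rintro _ ⟨k, rfl⟩
    exact Submodule.mem_orthogonal_singleton_iff_inner_left.2 (h k)
  exact Submodule.mem_orthogonal_singleton_iff_inner_left.1 (hle hu)

/-- If the sum of the backward spans of nonzero functions in `H₂` is not dense, then its orthogonal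
complement contains a unimodular function. -/
theorem exists_unimodular_mem_orthogonal {ι : Type*} [Nonempty ι] {g : ι → L2}
    (hg : ∀ j, g j ∈ H2) (hg0 : ∀ j, g j ≠ 0) (h : ¬ IsBackwardDeterministic g) :
    ∃ v : L2, (∀ᵐ t ∂circleMeasure, ‖v t‖ = 1) ∧
      ∀ j, ∀ k : ℕ, ⟪zpowMul (-(k : ℤ)) (g j), v⟫_ℂ = 0 := by
  set K : Submodule ℂ L2 := (⨆ j, backwardSpan (g j))ᗮ with hKdef
  have hK : ∀ v ∈ K, zpowMul 1 v ∈ K := by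
    intro v hv
    rw [hKdef, mem_orthogonal_iSup_backwardSpan] at hv ⊢
    intro j k
    rw [inner_zpowMul_zpowMul]
    have := hv j (k + 1)
    rwa [Nat.cast_succ, neg_add, ← sub_eq_add_neg] at this
  have hne : ∃ v ∈ K, zpowMul (-1) v ∉ K := by
    by_contra! hcon
    refine h (Submodule.topologicalClosure_eq_top_iff.2 ((Submodule.eq_bot_iff _).2 fun v hv => ?_))
    obtain ⟨j⟩ := ‹Nonempty ι›
    -- Invariance under `z⁻¹` makes all Fourier coefficients of `conj (g j) * v` vanish.
    have hz : (fun t => conj (g j t) * v t) =ᵐ[circleMeasure] 0 := by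
      refine ae_eq_zero_of_fourierCoeff_eq_zero (integrable_conj_mul _ _) fun m => ?_
      rw [← inner_zpowMul_left]
      have h1 := zpowMul_iterate_mem hcon hv m.toNat
      rw [hKdef, mem_orthogonal_iSup_backwardSpan] at h1
      have h2 := h1 j (-m).toNat
      rw [inner_zpowMul_zpowMul] at h2
      convert h2 using 3
      omega
    refine Lp.ext ?_
    filter_upwards [hz, ae_ne_zero_of_mem_H2 (hg j) (hg0 j), Lp.coeFn_zero ℂ 2 circleMeasure]
      with t a b c
    rw [c]
    have a' : conj (g j t) * v t = 0 := a
    exact (mul_eq_zero.1 a').resolve_left ((map_ne_zero _).2 b)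
  obtain ⟨v, hv, hv1⟩ := exists_unimodular_mem (Submodule.isClosed_orthogonal _) hK hne
  exact ⟨v, hv1, (mem_orthogonal_iSup_backwardSpan g v).1 hv⟩

/-- A unimodular `v` orthogonal to all `z ^ (-k) g`, `k ≥ 0`, makes `v * conj g` a function in
`H₂` of the same modulus as `g`. -/
theorem mul_conj_div_mem_innerQuotients {g v : L2} (hg : g ∈ H2) (hg0 : g ≠ 0)
    (hv : ∀ᵐ t ∂circleMeasure, ‖v t‖ = 1)
    (horth : ∀ k : ℕ, ⟪zpowMul (-(k : ℤ)) g, v⟫_ℂ = 0) :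
    (fun t => v t * (conj (g t) / g t)) ∈ innerQuotients := by
  have hne := ae_ne_zero_of_mem_H2 hg hg0
  have hmeas : AEStronglyMeasurable (fun t => v t * (conj (g t) / g t)) circleMeasure :=
    (Lp.aestronglyMeasurable v).mul
      ((Complex.continuous_conj.comp_aestronglyMeasurable (Lp.aestronglyMeasurable g)).div₀
        (Lp.aestronglyMeasurable g))
  have h1 : ∀ᵐ t ∂circleMeasure, ‖v t * (conj (g t) / g t)‖ = 1 := by
    filter_upwards [hv, hne] with t a b
    rw [norm_mul, a, norm_div, RCLike.norm_conj, div_self (norm_ne_zero_iff.2 b), one_mul]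
  -- The product with `g` is `v * conj g`, whose coefficients of index `-k` are given by `horth`.
  refine mem_innerQuotients_of_mul_mem_H2 hg hg0 hmeas h1 fun m hm => ?_
  have h2 := horth (-m).toNat
  rw [inner_zpowMul_left] at h2
  have hmm : -(((-m).toNat : ℕ) : ℤ) = m := by omega
  rw [hmm] at h2
  rw [← h2]
  refine congrFun (fourierCoeff_congr_ae ?_) m
  filter_upwards [coeFn_mulUnimodular _ hmeas h1 g, hne] with t a b
  rw [a]
  field_simp

/-- If every `(g i / conj (g i)) * (conj (g j) / g j)` is a quotient `φ j / ψ j` of inner functions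
and `p` is a common multiple of the `ψ j`, then `v = z p g i / conj (g i)` is orthogonal to all
backward spans, since `conj (g j) * v = z (p / ψ j) φ j g j` lies in `z H₂`. -/
theorem not_isBackwardDeterministic {ι : Type*} [Finite ι] {g : ι → L2}
    (hg : ∀ j, g j ∈ H2) (hg0 : ∀ j, g j ≠ 0) (i : ι)
    (h : ∀ j, (fun t => (g i t / conj (g i t)) * (conj (g j t) / g j t)) ∈ innerQuotients) :
    ¬ IsBackwardDeterministic g := by
  have := Fintype.ofFinite ι
  choose φ ψ hφ hψ hquot using h
  obtain ⟨p, hp, hpq⟩ := exists_isInner_common_multiple Finset.univ ψ fun j _ => hψ j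
  -- The extra factor `z` gives orthogonality for `k = 0` as well.
  obtain ⟨r, hr, hrc⟩ := (isInner_fourierLp zero_le_one).exists_mul hp
  have hnei := ae_ne_zero_of_mem_H2 (hg i) (hg0 i)
  have hmeas : AEStronglyMeasurable (fun t => g i t / conj (g i t)) circleMeasure :=
    (Lp.aestronglyMeasurable _).div₀
      (Complex.continuous_conj.comp_aestronglyMeasurable (Lp.aestronglyMeasurable _))
  have h1 : ∀ᵐ t ∂circleMeasure, ‖g i t / conj (g i t)‖ = 1 := by
    filter_upwards [hnei] with t b
    rw [norm_div, RCLike.norm_conj, div_self (norm_ne_zero_iff.2 b)]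
  let v : L2 := mulUnimodular _ hmeas h1 r
  have hv : v =ᵐ[circleMeasure] fun t => (g i t / conj (g i t)) * r t :=
    coeFn_mulUnimodular _ hmeas h1 r
  have hmem : v ∈ (⨆ j, backwardSpan (g j))ᗮ := by
    rw [mem_orthogonal_iSup_backwardSpan]
    intro j k
    obtain ⟨q, hq, hqc⟩ := hpq j (Finset.mem_univ j)
    obtain ⟨s, hs, hsc⟩ := hq.exists_mul (hφ j)
    let y : L2 := mulUnimodular s (Lp.aestronglyMeasurable s) hs.2 (g j)
    have hyc : y =ᵐ[circleMeasure] fun t => s t * g j t := coeFn_mulUnimodular _ _ _ _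
    have hy : y ∈ H2 := hs.mul_mem_H2 (hg j) hyc
    rw [inner_zpowMul_left]
    have hco : fourierCoeff (fun t => conj (g j t) * v t) (-(k : ℤ)) =
        fourierCoeff (zpowMul 1 y : 𝕋 → ℂ) (-(k : ℤ)) := by
      refine congrFun (fourierCoeff_congr_ae ?_) _
      filter_upwards [hv, hrc, coeFn_fourierLp (T := 2 * Real.pi) 2 1, hqc, hsc, hyc,
        coeFn_zpowMul 1 y, hquot j, ae_ne_zero_of_mem_H2 (hg j) (hg0 j), (hψ j).2]
        with t a b c d e f x z hgj hψ1
      have hψ0 : ψ j t ≠ 0 := norm_ne_zero_iff.1 (by rw [hψ1]; exact one_ne_zero)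
      have hz : g i t / conj (g i t) * conj (g j t) * ψ j t = φ j t * g j t := by
        field_simp at z ⊢
        linear_combination z
      rw [a, b, c, d, x, f, e]
      linear_combination (fourier 1 t * q t) * hz
    rw [hco, fourierCoeff_zpowMul]
    exact hy _ (by omega)
  intro hbd
  rw [IsBackwardDeterministic, Submodule.topologicalClosure_eq_top_iff] at hbd
  rw [hbd, Submodule.mem_bot] at hmem
  have hr0 : r = 0 := by
    have : mulUnimodular _ hmeas h1 r = 0 := hmem
    rwa [← norm_eq_zero, LinearIsometry.norm_map, norm_eq_zero] at this
  have hfalse : ∀ᵐ _ ∂circleMeasure, False := by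
    filter_upwards [hr.2, Lp.coeFn_zero ℂ 2 circleMeasure] with t a b
    rw [hr0, b] at a
    simp at a
  exact hfalse.exists.elim fun _ hx => hx

end HardyCircle

end

theorem corollary7 (n : ℕ) [NeZero n] (g : Fin n → HardyCircle.L2)
    (hg : ∀ j, g j ∈ HardyCircle.H2) (hg0 : ∀ j, g j ≠ 0) :
    HardyCircle.IsBackwardDeterministic g ↔
      ∃ j : Fin n, j ≠ 0 ∧
        (fun t : HardyCircle.𝕋 => (g 0 t / conj (g 0 t)) * (conj (g j t) / g j t)) ∉
          HardyCircle.innerQuotients := by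
  refine ⟨fun h => ?_, fun ⟨j, _, hj⟩ => ?_⟩
  · by_contra! hcon
    refine HardyCircle.not_isBackwardDeterministic hg hg0 0 (fun j => ?_) h
    by_cases hj : j = 0
    · -- For `j = 0` the quotient is the constant `1`, since `g 0` is nonzero almost everywhere.
      have hone := HardyCircle.isInner_fourierLp (le_refl 0)
      refine ⟨_, _, hone, hone, ?_⟩
      filter_upwards [HardyCircle.ae_ne_zero_of_mem_H2 (hg 0) (hg0 0), hone.2] with t a b
      have hb := norm_ne_zero_iff.1 (b.trans_ne one_ne_zero)
      have ha : conj (g 0 t) ≠ 0 := (map_ne_zero _).2 a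
      rw [hj, div_self hb]
      field_simp
    · exact hcon j hj
  · by_contra hcon
    obtain ⟨v, hv, horth⟩ := HardyCircle.exists_unimodular_mem_orthogonal hg hg0 hcon
    refine hj ?_
    have hq := HardyCircle.div_mem_innerQuotients
      (HardyCircle.mul_conj_div_mem_innerQuotients (hg j) (hg0 j) hv (horth j))
      (HardyCircle.mul_conj_div_mem_innerQuotients (hg 0) (hg0 0) hv (horth 0))
    obtain ⟨φ, ψ, hφ, hψ, h⟩ := hq
    refine ⟨φ, ψ, hφ, hψ, Filter.EventuallyEq.trans ?_ h⟩
    filter_upwards [hv, HardyCircle.ae_ne_zero_of_mem_H2 (hg 0) (hg0 0)] with t a b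
    have ha := norm_ne_zero_iff.1 (a.trans_ne one_ne_zero)
    have hb : conj (g 0 t) ≠ 0 := (map_ne_zero _).2 b
    field_simp
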